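/- Let $1\le k\le n$ and let $\mathbb M(n)$ be the space of $n\times n$ complex matrices. For $A\in\mathbb M(n)$ let $s_1(A)\ge\cdots\ge s_n(A)\ge 0$ be its singular values, let $|A|=(A^*A)^{1/2}$, let $\|A\|_{(k)}=s_1(A)+\cdots+s_k(A)$ be the Ky Fan $k$-norm and $\|A\|_\infty=s_1(A)$ the operator norm. A density matrix is a positive semidefinite matrix of trace $1$. Let $A=U|A|$ be a polar decomposition of $A$, with $U$ unitary, let $\mathscr W$ be any (complex) subspace of $\mathbb M(n)$, and let $\mathscr W^\perp=\{Y\in\mathbb M(n):\operatorname{tr}(X^*Y)=0\text{ for all }X\in\mathscr W\}$. Suppose that there exist density matrices $P_1,\dots,P_k\in\mathbb M(n)$ such that $\|\sum_{i=1}^kP_i\|_\infty\le 1$, $|A|P_i=s_i(A)P_i$ for $1\le i\le k$, and $U\sum_{i=1}^kP_i\in\mathscr W^\perp$. Then $A$ is Birkhoff–James orthogonal to $\mathscr W$ in $\|\cdot\|_{(k)}$, that is, $\|A+X\|_{(k)}\ge\|A\|_{(k)}$ for all $X\in\mathscr W$. If $s_k(A)>0$, the converse also holds: if $A$ is Birkhoff–James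 orthogonal to $\mathscr W$ in $\|\cdot\|_{(k)}$, then such density matrices $P_1,\dots,P_k$ exist. -/

import Mathlib

open scoped Matrix ComplexOrder MatrixOrder

noncomputable section

namespace KyFan

/-- The singular values of `A`, in decreasing order and with multiplicity, indexed from `0`:
`singularValue A i` is `s_{i+1}(A)`. -/
def singularValue {n : ℕ} (A : Matrix (Fin n) (Fin n) ℂ) (i : ℕ) : ℝ :=
  (Matrix.toEuclideanLin A).singularValues i

/-- The Ky Fan `k`-norm: the sum of the `k` largest singular values. -/
def kyFanNorm {n : ℕ} (k : ℕ) (A : Matrix (Fin n) (Fin n) ℂ) : ℝ :=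
  ∑ i ∈ Finset.range k, singularValue A i

/-- The operator (spectral) norm of a matrix acting on Euclidean space. -/
def spectralNorm {n : ℕ} (A : Matrix (Fin n) (Fin n) ℂ) : ℝ :=
  ‖Matrix.toEuclideanCLM (n := Fin n) (𝕜 := ℂ) A‖

/-- `|A|`, the positive semidefinite square root of `Aᴴ * A`. -/
def absMatrix {n : ℕ} (A : Matrix (Fin n) (Fin n) ℂ) : Matrix (Fin n) (Fin n) ℂ :=
  CFC.abs A

/-- `A = U |A|` with `U` unitary. -/
def IsPolarDecomposition {n : ℕ} (A U : Matrix (Fin n) (Fin n) ℂ) : Prop :=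
  U ∈ Matrix.unitaryGroup (Fin n) ℂ ∧ A = U * absMatrix A

/-- A density matrix: positive semidefinite with trace one. -/
def IsDensityMatrix {n : ℕ} (P : Matrix (Fin n) (Fin n) ℂ) : Prop :=
  P.PosSemidef ∧ P.trace = 1

/-- The orthogonal complement of `W` for the trace inner product `⟨X, Y⟩ = tr (Xᴴ * Y)`. -/
def traceOrthogonal {n : ℕ} (W : Submodule ℂ (Matrix (Fin n) (Fin n) ℂ)) :
    Submodule ℂ (Matrix (Fin n) (Fin n) ℂ) where
  carrier := {Y | ∀ X ∈ W, (Xᴴ * Y).trace = 0}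
  add_mem' := by
    intro a b ha hb X hX
    rw [Matrix.mul_add, Matrix.trace_add, ha X hX, hb X hX, add_zero]
  zero_mem' := by
    intro X _
    simp
  smul_mem' := by
    intro c a ha X hX
    rw [Matrix.mul_smul, Matrix.trace_smul, ha X hX, smul_zero]

/-- `A` is Birkhoff-James orthogonal to the subspace `W` with respect to `N`. -/
def IsBirkhoffJamesOrthogonal {n : ℕ} (N : Matrix (Fin n) (Fin n) ℂ → ℝ)
    (A : Matrix (Fin n) (Fin n) ℂ) (W : Submodule ℂ (Matrix (Fin n) (Fin n) ℂ)) : Prop :=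
  ∀ X ∈ W, N A ≤ N (A + X)

end KyFan

end

namespace KyFan

open Matrix

/-! The Ky Fan norm of `N` is the maximum of `Re tr ((WG)ᴴ N)` over unitary `W` and `0 ≤ G ≤ 1` of
trace `k` (`re_trace_le_kyFanNorm`, `exists_re_trace_eq_kyFanNorm`). Given the states, the
functional with `W = U` and `G = ∑ Pᵢ` kills the subspace and takes the value `‖A‖₍ₖ₎` at `A`, which
proves orthogonality.

Conversely, Hahn–Banach gives `Y` orthogonal to the subspace whose functional is dominated by the
norm and attains it at `A` (`exists_norming_functional`). Write `|A| = V S Vᴴ` and `H = (UV)ᴴ Y V`.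
Testing on unitaries (norm at most `k`) and on unitary multiples of rank-one projections (norm at
most 1) leaves no slack in the rearrangement inequality when `s_k > 0`. So `0 ≤ H ≤ 1`, `tr H = k`,
and the diagonal of `H` is 1 where `s_i > s_k` and 0 where `s_i < s_k` (`structure_of_norming`).
Positivity makes `H` block diagonal: identity, a free block on the `s_k`-eigenspace, zero.
`exists_states_of_structure` cuts this into `k` states, and conjugation by `V` carries them back. -/

/-! ### Singular value decomposition. -/

lemma singularValue_nonneg {n : ℕ} (A : Matrix (Fin n) (Fin n) ℂ) (i : ℕ) :
    0 ≤ singularValue A i :=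
  LinearMap.singularValues_nonneg _ _

lemma singularValue_antitone {n : ℕ} (A : Matrix (Fin n) (Fin n) ℂ) :
    Antitone (singularValue A) :=
  LinearMap.singularValues_antitone _

/-- The diagonal matrix of singular values. -/
noncomputable def singularDiagonal {n : ℕ} (A : Matrix (Fin n) (Fin n) ℂ) :
    Matrix (Fin n) (Fin n) ℂ :=
  diagonal fun i => ((singularValue A i : ℝ) : ℂ)

/-- The matrix whose columns are the vectors of an orthonormal basis. -/
noncomputable def basisMatrix {n : ℕ} (b : OrthonormalBasis (Fin n) ℂ (EuclideanSpace ℂ (Fin n))) :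
    Matrix (Fin n) (Fin n) ℂ :=
  of fun i j => b j i

lemma basisMatrix_mem_unitaryGroup {n : ℕ}
    (b : OrthonormalBasis (Fin n) ℂ (EuclideanSpace ℂ (Fin n))) :
    basisMatrix b ∈ unitaryGroup (Fin n) ℂ := by
  rw [mem_unitaryGroup_iff']
  ext i j
  have h := (orthonormal_iff_ite.1 b.orthonormal) i j
  rw [EuclideanSpace.inner_eq_star_dotProduct, dotProduct_comm] at h
  simpa [mul_apply, basisMatrix, star_eq_conjTranspose, dotProduct, one_apply] using h

/-- Eigenvectors of `Mᴴ M` have orthogonal images of length `s_i`. Gram–Schmidt only normalises the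
nonzero images, and it completes them to a basis where the image vanishes. -/
lemma exists_singular_value_decomposition {n : ℕ} (M : Matrix (Fin n) (Fin n) ℂ) :
    ∃ B ∈ unitaryGroup (Fin n) ℂ, ∃ V ∈ unitaryGroup (Fin n) ℂ,
      M * V = B * singularDiagonal M := by
  set T := toEuclideanLin M with hT
  have hn : Module.finrank ℂ (EuclideanSpace ℂ (Fin n)) = n := by simp
  set b := T.isSymmetric_adjoint_comp_self.eigenvectorBasis hn with hb
  have hin : ∀ i j, inner ℂ (T (b i)) (T (b j)) =
      if i = j then (((singularValue M j) ^ 2 : ℝ) : ℂ) else 0 := by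
    intro i j
    rw [← LinearMap.adjoint_inner_right, ← LinearMap.comp_apply, hb,
      LinearMap.IsSymmetric.apply_eigenvectorBasis, ← LinearMap.sq_singularValues_fin T hn,
      inner_smul_right, ← hb, orthonormal_iff_ite.1 b.orthonormal]
    simp [singularValue, hT]
  have hnorm : ∀ i : Fin n, ‖T (b i)‖ = singularValue M i := by
    intro i
    have h := hin i i
    rw [inner_self_eq_norm_sq_to_K, if_pos rfl] at h
    have h' : ‖T (b i)‖ ^ 2 = singularValue M i ^ 2 := by
      apply Complex.ofReal_injective
      rw [← h]
      simp
    exact (sq_eq_sq₀ (norm_nonneg _) (singularValue_nonneg _ _)).1 h'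
  have hn' : Module.finrank ℂ (EuclideanSpace ℂ (Fin n)) = Fintype.card (Fin n) := by simp
  set u := InnerProductSpace.gramSchmidtOrthonormalBasis hn' fun i => T (b i) with hu
  have hTu : ∀ i : Fin n, T (b i) = ((singularValue M i : ℝ) : ℂ) • u i := by
    intro i
    by_cases h0 : T (b i) = 0
    · have : singularValue M i = 0 := by rw [← hnorm, h0, norm_zero]
      simp [h0, this]
    · rw [hu, InnerProductSpace.gramSchmidtOrthonormalBasis_apply_of_orthogonal hn' _ h0, hnorm,
        smul_smul]
      · have : singularValue M i ≠ 0 := by rw [← hnorm]; exact norm_ne_zero_iff.2 h0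
        have h2 : ((singularValue M i : ℝ) : ℂ) ≠ 0 := by exact_mod_cast this
        simp [h2]
      · intro i j hij
        simp [hin, hij]
  refine ⟨basisMatrix u, basisMatrix_mem_unitaryGroup u, basisMatrix b,
    basisMatrix_mem_unitaryGroup b, ?_⟩
  ext i j
  have h := congrArg (fun v : EuclideanSpace ℂ (Fin n) => v i) (hTu j)
  simp only [hT, ofLp_toLpLin, PiLp.smul_apply, smul_eq_mul] at h
  rw [singularDiagonal, mul_diagonal]
  simp only [basisMatrix, mul_apply, of_apply]
  rw [mul_comm, ← h]
  rfl

lemma absMatrix_eq {n : ℕ} {M B V : Matrix (Fin n) (Fin n) ℂ}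
    (hB : B ∈ unitaryGroup (Fin n) ℂ) (hV : V ∈ unitaryGroup (Fin n) ℂ)
    (h : M * V = B * singularDiagonal M) : absMatrix M = V * singularDiagonal M * Vᴴ := by
  rw [mem_unitaryGroup_iff', star_eq_conjTranspose] at hB
  have hV' := mem_unitaryGroup_iff.1 hV
  rw [mem_unitaryGroup_iff', star_eq_conjTranspose] at hV
  rw [star_eq_conjTranspose] at hV'
  have hM : M = B * singularDiagonal M * Vᴴ := by rw [← h, mul_assoc, hV', mul_one]
  have hD : (singularDiagonal M).PosSemidef := by
    refine PosSemidef.diagonal fun i => ?_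
    simpa using singularValue_nonneg M i
  have hDh : (singularDiagonal M)ᴴ = singularDiagonal M := hD.1
  unfold absMatrix CFC.abs
  refine CFC.sqrt_unique ?_ (nonneg_iff_posSemidef.2 (hD.mul_mul_conjTranspose_same V))
  rw [star_eq_conjTranspose]
  generalize singularDiagonal M = D at *
  subst hM
  simp only [conjTranspose_mul, hDh, conjTranspose_conjTranspose]
  calc _ = V * D * (Vᴴ * V) * D * Vᴴ := by simp only [mul_assoc]
    _ = V * D * (Bᴴ * B) * D * Vᴴ := by rw [hV, hB]
    _ = _ := by simp only [mul_assoc]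

/-! ### Rearrangement inequality for weights in `[0,1]`. -/

lemma sum_range_eq_sum_fin {n k : ℕ} (hkn : k ≤ n) (d : ℕ → ℝ) :
    ∑ i ∈ Finset.range k, d i = ∑ i : Fin n, if (i : ℕ) < k then d i else 0 := by
  rw [Fin.sum_univ_eq_sum_range (fun i => if i < k then d i else 0) n, ← Finset.sum_filter]
  congr 1
  ext i
  simp only [Finset.mem_range, Finset.mem_filter]
  omega

lemma sum_ite_lt_one {n k : ℕ} (hkn : k ≤ n) :
    ∑ i : Fin n, (if (i : ℕ) < k then (1 : ℝ) else 0) = k := by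
  rw [← sum_range_eq_sum_fin hkn fun _ => 1]
  simp

/-- Termwise bound behind the rearrangement inequality for antitone weights. -/
lemma sub_ite_mul_sub_nonpos {n k : ℕ} {d : ℕ → ℝ} (hd : Antitone d)
    {w : Fin n → ℝ} (hw0 : ∀ i, 0 ≤ w i) (hw1 : ∀ i, w i ≤ 1) (i : Fin n) :
    (w i - if (i : ℕ) < k then 1 else 0) * (d i - d (k - 1)) ≤ 0 := by
  split_ifs with h
  · exact mul_nonpos_of_nonpos_of_nonneg (by linarith [hw1 i])
      (sub_nonneg.2 (hd (by omega)))
  · exact mul_nonpos_of_nonneg_of_nonpos (by linarith [hw0 i])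
      (sub_nonpos.2 (hd (by omega)))

/-- With the pivot `c = d (k - 1)` the left side has nonpositive terms, and the deficit `∑ w - k` is
isolated. This serves both the inequality and its equality case. -/
lemma sum_sub_ite_mul_sub {n k : ℕ} (hkn : k ≤ n) (d : ℕ → ℝ) (w : Fin n → ℝ) (c : ℝ) :
    ∑ i : Fin n, (w i - if (i : ℕ) < k then 1 else 0) * (d i - c) =
      ∑ i : Fin n, w i * d i - ∑ i ∈ Finset.range k, d i - c * (∑ i, w i - k) := by
  rw [← sum_ite_lt_one hkn, sum_range_eq_sum_fin hkn d, ← Finset.sum_sub_distrib,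
    ← Finset.sum_sub_distrib, Finset.mul_sum, ← Finset.sum_sub_distrib]
  refine Finset.sum_congr rfl fun i _ => ?_
  split_ifs <;> ring

lemma sum_mul_le_sum_range {n k : ℕ} (hkn : k ≤ n) {d : ℕ → ℝ} (hd : Antitone d)
    {w : Fin n → ℝ} (hw0 : ∀ i, 0 ≤ w i) (hw1 : ∀ i, w i ≤ 1)
    (hw : ∑ i, w i = k) : ∑ i : Fin n, w i * d i ≤ ∑ i ∈ Finset.range k, d i := by
  have h := sum_sub_ite_mul_sub hkn d w (d (k - 1))
  have h2 : ∑ i : Fin n, (w i - if (i : ℕ) < k then 1 else 0) * (d i - d (k - 1)) ≤ 0 :=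
    Finset.sum_nonpos fun i _ => sub_ite_mul_sub_nonpos hd hw0 hw1 i
  rw [hw, sub_self, mul_zero, sub_zero] at h
  linarith

/-! ### Variational formula for the Ky Fan norm. -/

lemma diag_re_nonneg {n : ℕ} {G : Matrix (Fin n) (Fin n) ℂ} (hG : G.PosSemidef) (i : Fin n) :
    0 ≤ (G i i).re :=
  (Complex.le_def.1 (hG.diag_nonneg (i := i))).1

/-- The trace is `∑ d_i (Cᴴ G B)_ii`. Positivity of `(B - C)ᴴ G (B - C)` bounds the real part of
each entry by the mean of the diagonal entries of `Bᴴ G B` and `Cᴴ G C`. These means are admissible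
weights of sum `k`. -/
lemma re_trace_mul_le {n k : ℕ} (hkn : k ≤ n) {G B C : Matrix (Fin n) (Fin n) ℂ}
    (hG : G.PosSemidef) (hG1 : (1 - G).PosSemidef) (htr : G.trace = k)
    (hB : B ∈ unitaryGroup (Fin n) ℂ) (hC : C ∈ unitaryGroup (Fin n) ℂ)
    {d : ℕ → ℝ} (hd : Antitone d) (hd0 : ∀ i, 0 ≤ d i) :
    (G * (B * diagonal (fun i : Fin n => (d i : ℂ)) * Cᴴ)).trace.re
      ≤ ∑ i ∈ Finset.range k, d i := by
  set w : Fin n → ℝ := fun i => (((Bᴴ * G * B) i i).re + ((Cᴴ * G * C) i i).re) / 2 with hw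
  have htr' : ∀ X ∈ unitaryGroup (Fin n) ℂ, ∑ i, ((Xᴴ * G * X) i i).re = k := by
    intro X hX
    rw [mem_unitaryGroup_iff, star_eq_conjTranspose] at hX
    have : (Xᴴ * G * X).trace = k := by
      rw [trace_mul_comm, ← mul_assoc, hX, one_mul, htr]
    have h2 := congrArg Complex.re this
    simpa [trace] using h2
  have h0 : ∀ X : Matrix (Fin n) (Fin n) ℂ, ∀ i, 0 ≤ ((Xᴴ * G * X) i i).re := fun X i =>
    diag_re_nonneg (hG.conjTranspose_mul_mul_same X) i
  have h1 : ∀ X ∈ unitaryGroup (Fin n) ℂ, ∀ i, ((Xᴴ * G * X) i i).re ≤ 1 := by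
    intro X hX i
    rw [mem_unitaryGroup_iff', star_eq_conjTranspose] at hX
    have := diag_re_nonneg (hG1.conjTranspose_mul_mul_same X) i
    rw [mul_sub, sub_mul, mul_one, hX] at this
    simpa using this
  refine le_trans ?_ (sum_mul_le_sum_range hkn hd (w := w)
    (fun i => by have := h0 B i; have := h0 C i; simp only [hw]; linarith)
    (fun i => by have := h1 B hB i; have := h1 C hC i; simp only [hw]; linarith) ?_)
  · have : (G * (B * diagonal (fun i : Fin n => (d i : ℂ)) * Cᴴ)).trace =
        ((Cᴴ * G * B) * diagonal (fun i : Fin n => (d i : ℂ))).trace := by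
      rw [← mul_assoc, trace_mul_comm]
      simp only [mul_assoc]
    rw [this]
    simp only [trace, diag_apply, mul_diagonal, Complex.re_sum, Complex.re_mul_ofReal]
    refine Finset.sum_le_sum fun i _ => mul_le_mul_of_nonneg_right ?_ (hd0 i)
    have h := h0 (B - C) i
    have hs : ((Cᴴ * G * B) i i).re = ((Bᴴ * G * C) i i).re := by
      have : Bᴴ * G * C = (Cᴴ * G * B)ᴴ := by
        simp only [conjTranspose_mul, conjTranspose_conjTranspose, hG.1.eq, mul_assoc]
      rw [this, conjTranspose_apply]
      simp
    simp only [conjTranspose_sub, sub_mul, mul_sub, Matrix.sub_apply, Complex.sub_re] at h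
    simp only [hw]
    linarith
  · simp only [hw]
    rw [← Finset.sum_div, Finset.sum_add_distrib, htr' B hB, htr' C hC]
    ring

lemma svd_eq {n : ℕ} {M B V : Matrix (Fin n) (Fin n) ℂ} (hV : V ∈ unitaryGroup (Fin n) ℂ)
    (h : M * V = B * singularDiagonal M) : M = B * singularDiagonal M * Vᴴ := by
  rw [mem_unitaryGroup_iff, star_eq_conjTranspose] at hV
  rw [← h, mul_assoc, hV, mul_one]

lemma conjTranspose_mem_unitaryGroup {n : ℕ} {U : Matrix (Fin n) (Fin n) ℂ}
    (hU : U ∈ unitaryGroup (Fin n) ℂ) : Uᴴ ∈ unitaryGroup (Fin n) ℂ :=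
  Unitary.star_mem hU

lemma re_trace_le_kyFanNorm {n k : ℕ} (hkn : k ≤ n) {W G : Matrix (Fin n) (Fin n) ℂ}
    (hW : W ∈ unitaryGroup (Fin n) ℂ) (hG : G.PosSemidef) (hG1 : (1 - G).PosSemidef)
    (htr : G.trace = k) (N : Matrix (Fin n) (Fin n) ℂ) :
    ((W * G)ᴴ * N).trace.re ≤ kyFanNorm k N := by
  obtain ⟨B, hB, V, hV, h⟩ := exists_singular_value_decomposition N
  have hN := svd_eq hV h
  have := re_trace_mul_le hkn hG hG1 htr (mul_mem (conjTranspose_mem_unitaryGroup hW) hB) hV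
    (singularValue_antitone N) (singularValue_nonneg N)
  have h2 : (W * G)ᴴ * N = G * (Wᴴ * B * singularDiagonal N * Vᴴ) := by
    conv_lhs => rw [hN]
    simp only [conjTranspose_mul, hG.1.eq, mul_assoc]
  rw [h2]
  exact this

/-- The maximum is attained at a unitary polar factor `B Vᴴ` of `N` and the projection onto the
first `k` right singular vectors. -/
lemma exists_re_trace_eq_kyFanNorm {n k : ℕ} (hkn : k ≤ n) (N : Matrix (Fin n) (Fin n) ℂ) :
    ∃ W ∈ unitaryGroup (Fin n) ℂ, ∃ G : Matrix (Fin n) (Fin n) ℂ,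
      G.PosSemidef ∧ (1 - G).PosSemidef ∧ G.trace = k ∧
      ((W * G)ᴴ * N).trace.re = kyFanNorm k N := by
  obtain ⟨B, hB, V, hV, h⟩ := exists_singular_value_decomposition N
  have hN := svd_eq hV h
  set E : Matrix (Fin n) (Fin n) ℂ := diagonal fun i => if (i : ℕ) < k then 1 else 0 with hE
  have hEp : E.PosSemidef := by
    refine PosSemidef.diagonal fun i => ?_
    simp only [Pi.zero_apply]
    split_ifs <;> simp
  have hE1 : (1 - E).PosSemidef := by
    rw [← diagonal_one, hE, diagonal_sub]
    refine PosSemidef.diagonal fun i => ?_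
    simp only [Pi.zero_apply]
    split_ifs <;> simp
  have hVV := mem_unitaryGroup_iff.1 hV
  have hVV' := mem_unitaryGroup_iff'.1 hV
  have hBB' := mem_unitaryGroup_iff'.1 hB
  rw [star_eq_conjTranspose] at hVV hVV' hBB'
  refine ⟨B * Vᴴ, mul_mem hB (conjTranspose_mem_unitaryGroup hV), V * E * Vᴴ,
    hEp.mul_mul_conjTranspose_same V, ?_, ?_, ?_⟩
  · have := hE1.mul_mul_conjTranspose_same V
    rwa [mul_sub, sub_mul, mul_one, hVV] at this
  · rw [trace_mul_comm, ← mul_assoc, hVV', one_mul, hE, trace_diagonal]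
    have := sum_ite_lt_one hkn
    exact_mod_cast congrArg Complex.ofReal this
  · have h2 : (B * Vᴴ * (V * E * Vᴴ))ᴴ * N = V * (E * singularDiagonal N * Vᴴ) := by
      conv_lhs => rw [hN]
      simp only [conjTranspose_mul, conjTranspose_conjTranspose, hEp.1.eq]
      calc _ = V * E * (Vᴴ * V) * (Bᴴ * B) * singularDiagonal N * Vᴴ := by
            simp only [mul_assoc]
        _ = _ := by rw [hVV', hBB']; simp only [mul_assoc, mul_one]
    rw [h2, trace_mul_comm, mul_assoc, hVV', mul_one, hE, singularDiagonal, diagonal_mul_diagonal,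
      trace_diagonal, kyFanNorm, sum_range_eq_sum_fin hkn, Complex.re_sum]
    refine Finset.sum_congr rfl fun i _ => ?_
    split_ifs <;> simp

/-! ### Norm properties and values at test matrices. -/

lemma kyFanNorm_add_le {n k : ℕ} (hkn : k ≤ n) (M N : Matrix (Fin n) (Fin n) ℂ) :
    kyFanNorm k (M + N) ≤ kyFanNorm k M + kyFanNorm k N := by
  obtain ⟨W, hW, G, hG, hG1, htr, h⟩ := exists_re_trace_eq_kyFanNorm hkn (M + N)
  rw [← h, mul_add, trace_add, Complex.add_re]
  exact add_le_add (re_trace_le_kyFanNorm hkn hW hG hG1 htr M)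
    (re_trace_le_kyFanNorm hkn hW hG hG1 htr N)

lemma kyFanNorm_smul_le {n k : ℕ} (hkn : k ≤ n) {c : ℝ} (hc : 0 ≤ c)
    (M : Matrix (Fin n) (Fin n) ℂ) : kyFanNorm k (c • M) ≤ c * kyFanNorm k M := by
  obtain ⟨W, hW, G, hG, hG1, htr, h⟩ := exists_re_trace_eq_kyFanNorm hkn (c • M)
  rw [← h, Matrix.mul_smul, trace_smul, Complex.smul_re, smul_eq_mul]
  exact mul_le_mul_of_nonneg_left (re_trace_le_kyFanNorm hkn hW hG hG1 htr M) hc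

lemma kyFanNorm_smul {n k : ℕ} (hkn : k ≤ n) {c : ℝ} (hc : 0 < c)
    (M : Matrix (Fin n) (Fin n) ℂ) : kyFanNorm k (c • M) = c * kyFanNorm k M := by
  refine le_antisymm (kyFanNorm_smul_le hkn hc.le M) ?_
  have h := kyFanNorm_smul_le (k := k) hkn (inv_nonneg.2 hc.le) (c • M)
  rw [smul_smul, inv_mul_cancel₀ hc.ne', one_smul] at h
  calc c * kyFanNorm k M ≤ c * (c⁻¹ * kyFanNorm k (c • M)) := by gcongr
    _ = _ := by field_simp

lemma kyFanNorm_nonneg {n : ℕ} (k : ℕ) (M : Matrix (Fin n) (Fin n) ℂ) : 0 ≤ kyFanNorm k M :=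
  Finset.sum_nonneg fun i _ => singularValue_nonneg M i

lemma kyFanNorm_zero {n : ℕ} (k : ℕ) : kyFanNorm k (0 : Matrix (Fin n) (Fin n) ℂ) = 0 := by
  simp [kyFanNorm, singularValue]

lemma re_trace_mul_unitary_le {n k : ℕ} (hkn : k ≤ n) {G Q : Matrix (Fin n) (Fin n) ℂ}
    (hG : G.PosSemidef) (hG1 : (1 - G).PosSemidef) (htr : G.trace = k)
    (hQ : Q ∈ unitaryGroup (Fin n) ℂ) : (G * Q).trace.re ≤ k := by
  have := re_trace_mul_le hkn hG hG1 htr hQ (one_mem _) (d := fun _ => 1) antitone_const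
    (fun _ => zero_le_one)
  simpa using this

lemma kyFanNorm_unitary_le {n k : ℕ} (hkn : k ≤ n) {Q : Matrix (Fin n) (Fin n) ℂ}
    (hQ : Q ∈ unitaryGroup (Fin n) ℂ) : kyFanNorm k Q ≤ k := by
  obtain ⟨W, hW, G, hG, hG1, htr, h⟩ := exists_re_trace_eq_kyFanNorm hkn Q
  rw [← h, conjTranspose_mul, hG.1.eq, mul_assoc]
  exact re_trace_mul_unitary_le hkn hG hG1 htr (mul_mem (conjTranspose_mem_unitaryGroup hW) hQ)

/-- The sum of all singular values dominates the Ky Fan norm. It is the trace of `P` times a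
unitary, hence at most 1 by the trace bound for `k = 1`. -/
lemma kyFanNorm_unitary_mul_state_mul_unitary_le_one {n k : ℕ} (hn : 1 ≤ n) (hkn : k ≤ n)
    {Q P R : Matrix (Fin n) (Fin n) ℂ} (hQ : Q ∈ unitaryGroup (Fin n) ℂ)
    (hR : R ∈ unitaryGroup (Fin n) ℂ) (hP : P.PosSemidef)
    (hP1 : (1 - P).PosSemidef) (htr : P.trace = 1) : kyFanNorm k (Q * P * R) ≤ 1 := by
  obtain ⟨B, hB, V, hV, h⟩ := exists_singular_value_decomposition (Q * P * R)
  have hBB' := mem_unitaryGroup_iff'.1 hB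
  rw [star_eq_conjTranspose] at hBB'
  have hD : singularDiagonal (Q * P * R) = Bᴴ * (Q * P * R * V) := by
    rw [h, ← mul_assoc, hBB', one_mul]
  have hle : kyFanNorm k (Q * P * R) ≤ (singularDiagonal (Q * P * R)).trace.re := by
    rw [kyFanNorm, singularDiagonal, trace_diagonal, Complex.re_sum]
    simp only [Complex.ofReal_re]
    rw [sum_range_eq_sum_fin hkn]
    refine Finset.sum_le_sum fun i _ => ?_
    split_ifs
    · exact le_rfl
    · exact singularValue_nonneg _ _
  refine hle.trans ?_
  have h2 : (singularDiagonal (Q * P * R)).trace = (P * (R * V * Bᴴ * Q)).trace := by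
    rw [hD, trace_mul_comm, show Q * P * R * V * Bᴴ = Q * (P * R * V * Bᴴ) by
      simp only [mul_assoc], trace_mul_comm]
    simp only [mul_assoc]
  rw [h2]
  simpa using re_trace_mul_unitary_le hn hP hP1 (by simpa using htr)
    (mul_mem (mul_mem (mul_mem hR hV) (conjTranspose_mem_unitaryGroup hB)) hQ)

/-! ### Supporting functionals via Hahn–Banach. -/

/-- Every real-linear functional on complex matrices is `M ↦ Re tr (Yᴴ M)` for some `Y`. -/
lemma exists_re_trace_eq {n : ℕ} (g : Matrix (Fin n) (Fin n) ℂ →ₗ[ℝ] ℝ) :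
    ∃ Y : Matrix (Fin n) (Fin n) ℂ, ∀ M, g M = (Yᴴ * M).trace.re := by
  -- The conjugate in `Yᴴ` turns `Re (conj y * m)` into `Re y * Re m + Im y * Im m`, so no sign is
  -- needed.
  refine ⟨of fun i j => ⟨g (single i j 1), g (single i j Complex.I)⟩, fun M => ?_⟩
  have hM : M = ∑ i, ∑ j, ((M i j).re • single i j (1 : ℂ) +
      (M i j).im • single i j Complex.I) := by
    conv_lhs => rw [matrix_eq_sum_single M]
    refine Finset.sum_congr rfl fun i _ => Finset.sum_congr rfl fun j _ => ?_
    rw [smul_single, smul_single, ← single_add]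
    congr 1
    simp
  conv_lhs => rw [hM]
  simp only [map_sum, map_add, map_smul, smul_eq_mul, trace, diag_apply, mul_apply,
    conjTranspose_apply, of_apply, Complex.re_sum]
  rw [Finset.sum_comm]
  refine Finset.sum_congr rfl fun i _ => Finset.sum_congr rfl fun j _ => ?_
  simp only [Complex.mul_re, Complex.star_def, Complex.conj_re, Complex.conj_im]
  ring

/-- On `W + ℝA` take the functional that is 0 on `W` and `‖A‖₍ₖ₎` at `A`. Birkhoff–James
orthogonality is exactly its domination by the norm, so it extends. -/
lemma exists_norming_functional {n k : ℕ} (hkn : k ≤ n) {A : Matrix (Fin n) (Fin n) ℂ}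
    (hA : 0 < kyFanNorm k A) {W : Submodule ℂ (Matrix (Fin n) (Fin n) ℂ)}
    (h : IsBirkhoffJamesOrthogonal (kyFanNorm k) A W) :
    ∃ Y ∈ traceOrthogonal W, (∀ M, (Yᴴ * M).trace.re ≤ kyFanNorm k M) ∧
      (Yᴴ * A).trace.re = kyFanNorm k A := by
  have hAW : A ∉ W.restrictScalars ℝ := by
    intro hmem
    have := h (-A) (W.neg_mem hmem)
    rw [add_neg_cancel, kyFanNorm_zero] at this
    linarith
  let f₀ : Matrix (Fin n) (Fin n) ℂ →ₗ.[ℝ] ℝ := ⟨W.restrictScalars ℝ, 0⟩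
  let f := f₀.supSpanSingleton A (kyFanNorm k A) hAW
  have hdom : ∀ x ∈ W, ∀ c : ℝ, ∃ hx : x + c • A ∈ f.domain,
      f ⟨x + c • A, hx⟩ = c * kyFanNorm k A := by
    intro x hx c
    refine ⟨?_, ?_⟩
    · rw [LinearPMap.domain_supSpanSingleton]
      exact Submodule.add_mem_sup hx (Submodule.mem_span_singleton.2 ⟨c, rfl⟩)
    · have := f₀.supSpanSingleton_apply_mk A (kyFanNorm k A) hAW x hx c
      rw [this]
      simp [f₀]
  obtain ⟨g, hg, hgN⟩ := exists_extension_of_le_sublinear f (kyFanNorm k)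
    (fun c hc x => kyFanNorm_smul hkn hc x) (kyFanNorm_add_le hkn) (by
      rintro ⟨y, hy⟩
      have hy' := hy
      rw [LinearPMap.domain_supSpanSingleton, Submodule.mem_sup] at hy'
      obtain ⟨x, hx, z, hz, rfl⟩ := hy'
      obtain ⟨c, rfl⟩ := Submodule.mem_span_singleton.1 hz
      obtain ⟨hx', he⟩ := hdom x hx c
      rw [he]
      rcases le_or_gt c 0 with hc | hc
      · exact (mul_nonpos_of_nonpos_of_nonneg hc hA.le).trans (kyFanNorm_nonneg _ _)
      · have hs : x + c • A = c • (A + c⁻¹ • x) := by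
          rw [smul_add, smul_smul, mul_inv_cancel₀ hc.ne', one_smul, add_comm]
        change _ ≤ kyFanNorm k (x + c • A)
        rw [hs, kyFanNorm_smul hkn hc]
        exact mul_le_mul_of_nonneg_left
          (h _ ((W.restrictScalars ℝ).smul_mem c⁻¹ hx)) hc.le)
  have hgW : ∀ x ∈ W, g x = 0 := by
    intro x hx
    obtain ⟨h1, h2⟩ := hdom x hx 0
    have := hg ⟨_, h1⟩
    rw [h2] at this
    simpa using this
  obtain ⟨Y, hY⟩ := exists_re_trace_eq g
  refine ⟨Y, ?_, fun M => hY M ▸ hgN M, ?_⟩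
  · intro X hX
    have h1 : (Xᴴ * Y).trace = star (Yᴴ * X).trace := by
      rw [← trace_conjTranspose, conjTranspose_mul, conjTranspose_conjTranspose]
    have h2 := hgW X hX
    -- `W` is a complex subspace: testing on `iX` kills the imaginary part of the trace.
    have h3 := hgW _ (W.smul_mem Complex.I hX)
    rw [hY] at h2 h3
    rw [Matrix.mul_smul, trace_smul, smul_eq_mul] at h3
    rw [h1, star_eq_zero]
    refine Complex.ext h2 ?_
    simpa using h3
  · rw [← hY]
    obtain ⟨h1, h2⟩ := hdom 0 W.zero_mem 1
    have := hg ⟨_, h1⟩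
    rw [h2] at this
    simpa using this

/-! ### Positivity and rigidity of a norming matrix. -/

/-- The projections `x xᴴ / ‖x‖²` recover the quadratic form of `K`. Over `ℂ`, a form with
nonnegative values already forces `K` to be Hermitian. -/
lemma posSemidef_of_forall_projection {n : ℕ} {K : Matrix (Fin n) (Fin n) ℂ}
    (h : ∀ P : Matrix (Fin n) (Fin n) ℂ, P * P = P → Pᴴ = P → P.trace = 1 →
      0 ≤ (K * P).trace) : K.PosSemidef := by
  rw [← isPositive_toEuclideanLin_iff, LinearMap.isPositive_iff_complex]
  have key : ∀ x : Fin n → ℂ, 0 ≤ star x ⬝ᵥ K *ᵥ x := by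
    intro x
    by_cases hx : x = 0
    · simp [hx]
    have hpos : 0 < star x ⬝ᵥ x := dotProduct_star_self_pos_iff.2 hx
    have hne := hpos.ne'
    have hr : 0 ≤ (star x ⬝ᵥ x)⁻¹ := (inv_pos.2 hpos).le
    have hstar : star (star x ⬝ᵥ x)⁻¹ = (star x ⬝ᵥ x)⁻¹ := (IsSelfAdjoint.of_nonneg hr).star_eq
    have := h ((star x ⬝ᵥ x)⁻¹ • vecMulVec x (star x)) ?_ ?_ ?_
    · rw [Matrix.mul_smul, mul_vecMulVec, trace_smul, trace_vecMulVec, smul_eq_mul,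
        dotProduct_comm (K *ᵥ x)] at this
      have h2 := mul_nonneg hpos.le this
      rwa [← mul_assoc, mul_inv_cancel₀ hne, one_mul] at h2
    · rw [Matrix.smul_mul, Matrix.mul_smul, vecMulVec_mul_vecMulVec, smul_smul, vecMulVec_smul,
        smul_smul, mul_assoc, inv_mul_cancel₀ hne, mul_one]
    · rw [conjTranspose_smul, hstar, conjTranspose_vecMulVec, star_star]
    · rw [trace_smul, trace_vecMulVec, smul_eq_mul, dotProduct_comm x, inv_mul_cancel₀ hne]
  intro x
  have hx := key x.ofLp
  have hin : inner ℂ (toEuclideanLin K x) x = star (star x.ofLp ⬝ᵥ K *ᵥ x.ofLp) := by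
    rw [EuclideanSpace.inner_eq_star_dotProduct, ofLp_toLpLin, toLin'_apply, dotProduct_comm,
      star_dotProduct]
  have h3 : 0 ≤ inner ℂ (toEuclideanLin K x) x := hin ▸ star_nonneg_iff.2 hx
  obtain ⟨hre, him⟩ := Complex.le_def.1 h3
  exact ⟨Complex.ext (by simp) (by simpa using him), hre⟩

lemma row_eq_zero_of_diag_eq_zero {n : ℕ} {H : Matrix (Fin n) (Fin n) ℂ} (hH : H.PosSemidef)
    {i : Fin n} (hi : H i i = 0) (j : Fin n) : H i j = 0 := by
  have h := (hH.dotProduct_mulVec_zero_iff (Pi.single i 1)).1 (by simpa using hi)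
  have h2 := congrFun h j
  have h3 : H j i = 0 := by simpa using h2
  rw [← hH.1.apply, h3, star_zero]

lemma posSemidef_of_projection {n : ℕ} {P : Matrix (Fin n) (Fin n) ℂ} (hP : P * P = P)
    (hP' : Pᴴ = P) : P.PosSemidef := by
  have := posSemidef_conjTranspose_mul_self P
  rwa [hP', hP] at this

lemma one_sub_posSemidef_of_projection {n : ℕ} {P : Matrix (Fin n) (Fin n) ℂ} (hP : P * P = P)
    (hP' : Pᴴ = P) : (1 - P).PosSemidef := by
  refine posSemidef_of_projection ?_ (by simp [hP'])
  simp [mul_sub, sub_mul, hP]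

lemma one_add_smul_projection_mem_unitaryGroup {n : ℕ} {P : Matrix (Fin n) (Fin n) ℂ}
    (hP : P * P = P) (hP' : Pᴴ = P) {ω : ℂ} (hω : star ω * ω = 1) :
    1 + (ω - 1) • P ∈ unitaryGroup (Fin n) ℂ := by
  rw [mem_unitaryGroup_iff', star_eq_conjTranspose]
  simp only [conjTranspose_add, conjTranspose_one, conjTranspose_smul, hP', add_mul, mul_add,
    one_mul, mul_one, Matrix.smul_mul, Matrix.mul_smul, hP, smul_smul]
  rw [add_assoc, ← add_smul, ← add_smul, star_sub, star_one,
    show star ω - 1 + (ω - 1 + (ω - 1) * (star ω - 1)) = star ω * ω - 1 by ring, hω, sub_self,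
    zero_smul, add_zero]

/-- Rotating `z` to the positive axis by `ω = conj z / ‖z‖` gives `‖z‖ ≤ Re z`. -/
lemma nonneg_of_forall_re_mul_le {z : ℂ} (h : ∀ ω : ℂ, star ω * ω = 1 → (ω * z).re ≤ z.re) :
    0 ≤ z := by
  by_cases hz : z = 0
  · simp [hz]
  have hn : ((‖z‖ : ℝ) : ℂ) ≠ 0 := by simpa using hz
  have h1 : star z * z = (‖z‖ : ℂ) * ‖z‖ := by
    rw [Complex.star_def, ← Complex.normSq_eq_conj_mul_self, Complex.normSq_eq_norm_sq]
    push_cast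
    ring
  have := h (star z / ‖z‖) (by
    rw [star_div₀, star_star, div_mul_div_comm, mul_comm z, h1, Complex.star_def,
      Complex.conj_ofReal, div_self (mul_ne_zero hn hn)])
  rw [div_mul_eq_mul_div, h1, mul_div_assoc, div_self hn, mul_one, Complex.ofReal_re] at this
  have hre : z.re = ‖z‖ := le_antisymm (Complex.re_le_norm z) this
  exact Complex.nonneg_iff.2 ⟨hre ▸ norm_nonneg z, ((Complex.abs_re_eq_norm.1 (by
    rw [hre, abs_of_nonneg (norm_nonneg z)])).symm)⟩

lemma single_projection {n : ℕ} (i : Fin n) :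
    single i i (1 : ℂ) * single i i 1 = single i i 1 ∧
      (single i i (1 : ℂ))ᴴ = single i i 1 ∧ (single i i (1 : ℂ)).trace = 1 :=
  ⟨by simp, by simp, by simp⟩

lemma trace_diagonal_conjTranspose_mul {n : ℕ} (H : Matrix (Fin n) (Fin n) ℂ) (d : Fin n → ℝ) :
    (Hᴴ * diagonal fun i => (d i : ℂ)).trace.re = ∑ i, (H i i).re * d i := by
  simp [trace, mul_diagonal, Complex.re_sum]

/-- The hypothesis `hmax` is the equality case of rearrangement, which fixes the diagonal off the
ties with `s (k - 1)`. It also gives `Re tr Hᴴ = k`, so `Q = 1` maximises `Re tr (Hᴴ Q)` over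
unitaries. Rotating the phase on a rank-one projection then yields positivity. -/
lemma structure_of_norming {n k : ℕ} (hkn : k ≤ n) {H : Matrix (Fin n) (Fin n) ℂ} {s : ℕ → ℝ}
    (hs : Antitone s) (hs0 : ∀ i, 0 ≤ s i) (hpos : 0 < s (k - 1))
    (hunit : ∀ Q ∈ unitaryGroup (Fin n) ℂ, (Hᴴ * Q).trace.re ≤ k)
    (hproj : ∀ P : Matrix (Fin n) (Fin n) ℂ, P * P = P → Pᴴ = P → P.trace = 1 →
      (Hᴴ * P).trace.re ≤ 1)
    (hmax : ∑ i : Fin n, (H i i).re * s i = ∑ i ∈ Finset.range k, s i) :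
    H.PosSemidef ∧ (1 - H).PosSemidef ∧ H.trace = k ∧
      (∀ i : Fin n, s (k - 1) < s i → H i i = 1) ∧
      (∀ i : Fin n, s i < s (k - 1) → H i i = 0) := by
  -- Diagonal entries are not yet known to be nonnegative; their positive parts are admissible
  -- weights.
  set w : Fin n → ℝ := fun i => max (H i i).re 0 with hw
  have hle1 : ∀ i, (H i i).re ≤ 1 := by
    intro i
    obtain ⟨ha, hb, hc⟩ := single_projection i
    have := hproj _ ha hb hc
    simpa [trace_mul_comm _ (single i i (1 : ℂ)), trace_single_mul] using this
  have hw0 : ∀ i, 0 ≤ w i := fun i => le_max_right _ _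
  have hw1 : ∀ i, w i ≤ 1 := fun i => max_le (hle1 i) zero_le_one
  have hwle : ∀ i, (H i i).re ≤ w i := fun i => le_max_left _ _
  have habs : ∑ i, |(H i i).re| ≤ k := by
    -- A diagonal matrix of signs bounds the sum of absolute values.
    have := hunit (diagonal fun i => (((if (H i i).re < 0 then -1 else 1 : ℝ)) : ℂ)) (by
      rw [mem_unitaryGroup_iff', star_eq_conjTranspose, diagonal_conjTranspose,
        diagonal_mul_diagonal, ← diagonal_one]
      congr 1
      ext i
      simp only [Pi.star_apply]
      split_ifs <;> simp)
    rw [trace_diagonal_conjTranspose_mul] at this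
    refine le_trans (Finset.sum_le_sum fun i _ => ?_) this
    split_ifs with h
    · rw [abs_of_neg h]; linarith
    · rw [abs_of_nonneg (not_lt.1 h)]; linarith
  have hwabs : ∀ i, w i ≤ |(H i i).re| := fun i => max_le (le_abs_self _) (abs_nonneg _)
  have hwk : ∑ i, w i ≤ k := (Finset.sum_le_sum fun i _ => hwabs i).trans habs
  have hge : ∑ i ∈ Finset.range k, s i ≤ ∑ i : Fin n, w i * s i := by
    rw [← hmax]
    exact Finset.sum_le_sum fun i _ => mul_le_mul_of_nonneg_right (hwle i) (hs0 i)
  have hsum := sum_sub_ite_mul_sub hkn s w (s (k - 1))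
  have hterm := sub_ite_mul_sub_nonpos (k := k) hs hw0 hw1
  have hnonpos := Finset.sum_nonpos fun i (_ : i ∈ Finset.univ) => hterm i
  have hsumw : ∑ i, w i = k := by
    refine le_antisymm hwk ?_
    by_contra hlt
    push Not at hlt
    -- Positivity of the `k`-th singular value is essential: only then does a total weight below `k`
    -- lose value.
    have : s (k - 1) * (∑ i, w i - k) < 0 := mul_neg_of_pos_of_neg hpos (by linarith)
    linarith
  rw [hsumw, sub_self, mul_zero, sub_zero] at hsum
  have hzero : ∑ i : Fin n, (w i - if (i : ℕ) < k then 1 else 0) * (s i - s (k - 1)) = 0 :=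
    le_antisymm hnonpos (by linarith)
  have hterm0 := (Finset.sum_eq_zero_iff_of_nonpos fun i _ => hterm i).1 hzero
  have hwH : ∀ i, (H i i).re = w i := by
    -- Since `∑ |Re H_ii| ≤ k = ∑ w`, the negative parts vanish.
    have h1 : ∑ i, (|(H i i).re| - w i) = 0 := by
      refine le_antisymm ?_ (Finset.sum_nonneg fun i _ => sub_nonneg.2 (hwabs i))
      rw [Finset.sum_sub_distrib]
      linarith
    intro i
    have h2 := (Finset.sum_eq_zero_iff_of_nonneg fun i _ => sub_nonneg.2 (hwabs i)).1 h1 i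
      (Finset.mem_univ i)
    simp only [hw] at h2 ⊢
    rcases le_total 0 (H i i).re with h | h
    · rw [max_eq_left h]
    · rw [max_eq_right h, sub_zero, abs_eq_zero] at h2
      rw [h2, max_self]
  have htrre : (Hᴴ).trace.re = k := by
    rw [trace_conjTranspose, ← hsumw]
    simp [trace, Complex.re_sum, hwH]
  have hprojpos : ∀ P : Matrix (Fin n) (Fin n) ℂ, P * P = P → Pᴴ = P → P.trace = 1 →
      0 ≤ (Hᴴ * P).trace := by
    intro P hP hP' _
    refine nonneg_of_forall_re_mul_le fun ω hω => ?_
    have := hunit _ (one_add_smul_projection_mem_unitaryGroup hP hP' hω)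
    rw [mul_add, mul_one, trace_add, Matrix.mul_smul, trace_smul, smul_eq_mul, Complex.add_re,
      htrre, sub_mul, one_mul, Complex.sub_re] at this
    linarith
  have hH' : Hᴴ.PosSemidef := posSemidef_of_forall_projection hprojpos
  have hH : H.PosSemidef := posSemidef_conjTranspose_iff.1 hH'
  rw [hH.1.eq] at htrre hprojpos hproj
  have hdiag : ∀ i, H i i = (w i : ℂ) := fun i => by
    rw [← hwH i]
    exact Complex.eq_re_of_ofReal_le (r := 0) (by simpa using hH.diag_nonneg)
  refine ⟨hH, posSemidef_of_forall_projection fun P hP hP' htr => ?_, ?_, fun i hi => ?_,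
    fun i hi => ?_⟩
  · have h1 := hproj P hP hP' htr
    have h2 := Complex.nonneg_iff.1 (hprojpos P hP hP' htr)
    rw [sub_mul, one_mul, trace_sub, htr, Complex.nonneg_iff]
    simp only [Complex.sub_re, Complex.one_re, Complex.sub_im, Complex.one_im]
    exact ⟨by linarith, by linarith [h2.2]⟩
  · simp only [trace, diag_apply, hdiag]
    exact_mod_cast congrArg Complex.ofReal hsumw
  · have hik : (i : ℕ) < k := by
      by_contra h
      exact absurd (hs (show k - 1 ≤ (i : ℕ) by omega)) (not_le.2 hi)
    have h := hterm0 i (Finset.mem_univ i)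
    rw [if_pos hik, mul_eq_zero] at h
    have : w i = 1 := by rcases h with h | h <;> linarith
    rw [hdiag, this, Complex.ofReal_one]
  · have hik : ¬ (i : ℕ) < k := by
      intro h
      exact absurd (hs (show (i : ℕ) ≤ k - 1 by omega)) (not_le.2 hi)
    have h := hterm0 i (Finset.mem_univ i)
    rw [if_neg hik, mul_eq_zero] at h
    have : w i = 0 := by rcases h with h | h <;> linarith
    rw [hdiag, this, Complex.ofReal_zero]

/-! ### Splitting into density matrices. -/

open scoped Matrix.Norms.L2Operator in
lemma spectralNorm_le_one_iff {n : ℕ} {G : Matrix (Fin n) (Fin n) ℂ} (hG : G.PosSemidef) :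
    spectralNorm G ≤ 1 ↔ (1 - G).PosSemidef := by
  rw [← le_iff, ← CStarAlgebra.norm_le_one_iff_of_nonneg G (nonneg_iff_posSemidef.2 hG)]
  rfl

lemma diagonal_mul_state {n : ℕ} {d : Fin n → ℂ} {P : Matrix (Fin n) (Fin n) ℂ} {c : ℂ}
    (h : ∀ a b, d a ≠ c → P a b = 0) : diagonal d * P = c • P := by
  ext a b
  rw [diagonal_mul, Matrix.smul_apply, smul_eq_mul]
  by_cases hd : d a = c
  · rw [hd]
  · rw [h a b hd, mul_zero, mul_zero]

/-- A matrix `0 ≤ H ≤ 1` of trace `k` which is supported on the eigenvectors of the `k` largest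
entries of `s` is a sum of density matrices supported on the corresponding eigenspaces. -/
lemma exists_states_of_structure {n k : ℕ} (hk : 1 ≤ k) (hkn : k ≤ n)
    {H : Matrix (Fin n) (Fin n) ℂ} {s : ℕ → ℝ} (hs : Antitone s)
    (hH : H.PosSemidef) (hH1 : (1 - H).PosSemidef) (htr : H.trace = k)
    (hone : ∀ i : Fin n, s (k - 1) < s i → H i i = 1)
    (hzero : ∀ i : Fin n, s i < s (k - 1) → H i i = 0) :
    ∃ P : Fin k → Matrix (Fin n) (Fin n) ℂ, (∀ i, IsDensityMatrix (P i)) ∧ ∑ i, P i = H ∧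
      ∀ i, diagonal (fun j : Fin n => ((s j : ℝ) : ℂ)) * P i = ((s i : ℝ) : ℂ) • P i := by
  set c := s (k - 1) with hc
  -- The compression by `D` removes the block with `s_j > c`, where `H` is the identity.
  set D : Matrix (Fin n) (Fin n) ℂ := diagonal fun j => if c < s j then 0 else 1 with hD
  set H' := D * H * D with hH'
  have hDh : Dᴴ = D := by
    rw [hD, diagonal_conjTranspose]
    congr 1
    ext j
    simp only [Pi.star_apply]
    split_ifs <;> simp
  have hH'p : H'.PosSemidef := by
    have := hH.conjTranspose_mul_mul_same D
    rwa [hDh] at this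
  set S := Finset.univ.filter fun i : Fin k => c < s i with hS
  set T := Finset.univ.filter fun i : Fin k => ¬ c < s i with hT
  have hrow : ∀ i : Fin n, c < s i → ∀ j, H i j = if i = j then 1 else 0 := by
    intro i hi j
    -- A diagonal entry 1 of `H` is a zero diagonal entry of the positive matrix `1 - H`, so its
    -- whole row vanishes there.
    have := row_eq_zero_of_diag_eq_zero hH1 (i := i) (by simp [hone i hi]) j
    rw [Matrix.sub_apply, one_apply, sub_eq_zero] at this
    exact this.symm
  have hcol : ∀ j : Fin n, c < s j → ∀ i, H i j = if i = j then 1 else 0 := by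
    intro j hj i
    rw [← hH.1.apply, hrow j hj i]
    by_cases h : i = j
    · simp [h]
    · simp [h, Ne.symm h]
  have hH'apply : ∀ a b, H' a b = (if c < s a then 0 else 1) * H a b *
      (if c < s b then 0 else 1) := by
    intro a b
    rw [hH', hD, mul_diagonal, diagonal_mul]
  have hsum : ∑ i ∈ S, single (Fin.castLE hkn i) (Fin.castLE hkn i) (1 : ℂ) =
      diagonal fun j : Fin n => if c < s j then (1 : ℂ) else 0 := by
    ext a b
    rw [Matrix.sum_apply, diagonal_apply]
    simp only [single_apply]
    by_cases ha : c < s a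
    · have hak : (a : ℕ) < k := by
        by_contra h
        exact absurd (hs (show k - 1 ≤ (a : ℕ) by omega)) (not_le.2 ha)
      have : (⟨a, hak⟩ : Fin k) ∈ S := by simpa [hS] using ha
      rw [Finset.sum_eq_single_of_mem _ this]
      · simp [ha, Fin.castLE]
      · intro i _ hi
        rw [if_neg]
        rintro ⟨h, -⟩
        exact hi (Fin.ext (by simpa using congrArg Fin.val h))
    · rw [Finset.sum_eq_zero]
      · simp [ha]
      · intro i hi
        rw [if_neg]
        rintro ⟨rfl, -⟩
        exact ha (by simpa [hS] using hi)
  have hdecomp : (∑ i ∈ S, single (Fin.castLE hkn i) (Fin.castLE hkn i) (1 : ℂ)) + H' = H := by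
    rw [hsum]
    ext a b
    rw [Matrix.add_apply, diagonal_apply, hH'apply]
    by_cases ha : c < s a
    · rw [hrow a ha b]
      simp [ha]
    · by_cases hb : c < s b
      · rw [hcol b hb a]
        by_cases hab : a = b
        · exact absurd (hab ▸ hb) ha
        · simp [hab]
      · simp [ha, hb]
  have hcard : (S.card : ℂ) + T.card = k := by
    have := Finset.card_filter_add_card_filter_not (s := (Finset.univ : Finset (Fin k)))
      fun i : Fin k => c < s i
    rw [Finset.card_univ, Fintype.card_fin] at this
    exact_mod_cast this
  have hTne : (T.card : ℂ) ≠ 0 := by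
    have : (⟨k - 1, by omega⟩ : Fin k) ∈ T := by simp [hT, hc]
    exact_mod_cast (Finset.card_pos.2 ⟨_, this⟩).ne'
  have htrH' : H'.trace = T.card := by
    have := congrArg trace hdecomp
    rw [trace_add, trace_sum, htr, ← hcard] at this
    simpa using this
  have hTc : ∀ i : Fin k, ¬ c < s i → s i = c := fun i hi =>
    le_antisymm (not_lt.1 hi) (hs (by omega))
  -- Indices above the tie take coordinate projections. The `|T|` tied indices share `H'` equally,
  -- as its trace is `k - |S| = |T|`.
  refine ⟨fun i => if c < s i then single (Fin.castLE hkn i) (Fin.castLE hkn i) 1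
    else (T.card : ℂ)⁻¹ • H', fun i => ?_, ?_, fun i => ?_⟩
  · dsimp only
    split_ifs with hi
    · obtain ⟨h1, h2, h3⟩ := single_projection (Fin.castLE hkn i)
      exact ⟨posSemidef_of_projection h1 h2, h3⟩
    · refine ⟨hH'p.smul ?_, ?_⟩
      · exact inv_nonneg.2 (Nat.cast_nonneg _)
      · rw [trace_smul, htrH', smul_eq_mul, inv_mul_cancel₀ hTne]
  · rw [Finset.sum_ite, Finset.sum_const, ← hS, ← hT, ← Nat.cast_smul_eq_nsmul ℂ, smul_smul,
      mul_inv_cancel₀ hTne, one_smul, hdecomp]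
  · refine diagonal_mul_state fun a b hab => ?_
    have hab' : s a ≠ s i := fun h => hab (by rw [h])
    dsimp only
    split_ifs with hi
    · rw [single_apply, if_neg]
      rintro ⟨rfl, -⟩
      exact hab' rfl
    · rw [hTc i hi] at hab'
      rw [Matrix.smul_apply, hH'apply]
      by_cases ha : c < s a
      · simp [ha]
      · rw [row_eq_zero_of_diag_eq_zero hH (hzero a (lt_of_le_of_ne (not_lt.1 ha) hab')) b]
        simp

/-! ### The two implications. -/

lemma isBirkhoffJamesOrthogonal_of_states {n k : ℕ} (hkn : k ≤ n)
    {A U : Matrix (Fin n) (Fin n) ℂ} (hU : IsPolarDecomposition A U)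
    {W : Submodule ℂ (Matrix (Fin n) (Fin n) ℂ)} {P : Fin k → Matrix (Fin n) (Fin n) ℂ}
    (hP : ∀ i, IsDensityMatrix (P i)) (hsum : spectralNorm (∑ i, P i) ≤ 1)
    (heig : ∀ i, absMatrix A * P i = ((singularValue A i : ℝ) : ℂ) • P i)
    (horth : U * ∑ i, P i ∈ traceOrthogonal W) :
    IsBirkhoffJamesOrthogonal (kyFanNorm k) A W := by
  intro X hX
  have hG : (∑ i, P i).PosSemidef := posSemidef_sum _ fun i _ => (hP i).1
  have htr : (∑ i, P i).trace = k := by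
    rw [trace_sum, Finset.sum_congr rfl fun i _ => (hP i).2]
    simp
  refine le_trans (le_of_eq ?_) (re_trace_le_kyFanNorm hkn hU.1 hG
    ((spectralNorm_le_one_iff hG).1 hsum) htr (A + X))
  have hUU := mem_unitaryGroup_iff'.1 hU.1
  rw [star_eq_conjTranspose] at hUU
  have hX0 : ((U * ∑ i, P i)ᴴ * X).trace = 0 := by
    rw [← star_eq_zero, ← trace_conjTranspose, conjTranspose_mul, conjTranspose_conjTranspose]
    exact horth X hX
  have hA : (U * ∑ i, P i)ᴴ * A = (∑ i, P i) * absMatrix A := by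
    conv_lhs => rw [hU.2]
    rw [conjTranspose_mul, hG.1.eq, mul_assoc, ← mul_assoc Uᴴ, hUU, one_mul]
  rw [mul_add, trace_add, hX0, add_zero, hA, trace_mul_comm, Finset.mul_sum, trace_sum,
    Finset.sum_congr rfl fun i _ => by rw [heig i, trace_smul, (hP i).2], kyFanNorm,
    Complex.re_sum, ← Fin.sum_univ_eq_sum_range]
  simp

lemma exists_states_of_isBirkhoffJamesOrthogonal {n k : ℕ} (hk : 1 ≤ k) (hkn : k ≤ n)
    {A U : Matrix (Fin n) (Fin n) ℂ} (hU : IsPolarDecomposition A U)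
    {W : Submodule ℂ (Matrix (Fin n) (Fin n) ℂ)} (hpos : 0 < singularValue A (k - 1))
    (h : IsBirkhoffJamesOrthogonal (kyFanNorm k) A W) :
    ∃ P : Fin k → Matrix (Fin n) (Fin n) ℂ, (∀ i, IsDensityMatrix (P i)) ∧
      spectralNorm (∑ i, P i) ≤ 1 ∧
      (∀ i, absMatrix A * P i = ((singularValue A i : ℝ) : ℂ) • P i) ∧
      U * ∑ i, P i ∈ traceOrthogonal W := by
  have hA : 0 < kyFanNorm k A :=
    Finset.sum_pos' (fun i _ => singularValue_nonneg A i)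
      ⟨k - 1, Finset.mem_range.2 (by omega), hpos⟩
  obtain ⟨Y, hYW, hYle, hYA⟩ := exists_norming_functional hkn hA h
  obtain ⟨B, hB, V, hV, hsvd⟩ := exists_singular_value_decomposition A
  have habs := absMatrix_eq hB hV hsvd
  have hVV := mem_unitaryGroup_iff.1 hV
  have hVV' := mem_unitaryGroup_iff'.1 hV
  have hUU := mem_unitaryGroup_iff.1 hU.1
  rw [star_eq_conjTranspose] at hVV hVV' hUU
  have hVs := conjTranspose_mem_unitaryGroup hV
  have hUV := mul_mem hU.1 hV
  -- The left factor is `U * V`, not `B`: when `A` is singular the unitary polar factor is not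
  -- unique, and the conclusion concerns the given `U`.
  set H := (U * V)ᴴ * Y * V with hH
  have htrace : ∀ M, (Hᴴ * M).trace = (Yᴴ * (U * V * M * Vᴴ)).trace := by
    intro M
    have e1 : Hᴴ * M = Vᴴ * (Yᴴ * (U * V * M)) := by
      simp only [hH, conjTranspose_mul, conjTranspose_conjTranspose, mul_assoc]
    rw [e1, trace_mul_comm]
    simp only [mul_assoc]
  have hAeq : A = U * V * singularDiagonal A * Vᴴ := by
    conv_lhs => rw [hU.2, habs]
    simp only [mul_assoc]
  obtain ⟨h1, h2, h3, h4, h5⟩ := structure_of_norming hkn (H := H) (singularValue_antitone A)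
    (singularValue_nonneg A) hpos
    (fun Q hQ => by
      rw [htrace]
      exact (hYle _).trans (kyFanNorm_unitary_le hkn (mul_mem (mul_mem hUV hQ) hVs)))
    (fun P hP hP' htr => by
      rw [htrace]
      exact (hYle _).trans (kyFanNorm_unitary_mul_state_mul_unitary_le_one (hk.trans hkn) hkn hUV
        hVs (posSemidef_of_projection hP hP') (one_sub_posSemidef_of_projection hP hP') htr))
    (by
      rw [← trace_diagonal_conjTranspose_mul, htrace]
      exact (congrArg (fun M => (Yᴴ * M).trace.re) hAeq).symm.trans hYA)
  obtain ⟨P, hP, hPH, hPe⟩ := exists_states_of_structure hk hkn (singularValue_antitone A)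
    h1 h2 h3 h4 h5
  have hsum : ∑ i, V * P i * Vᴴ = V * H * Vᴴ := by
    rw [← hPH, Finset.mul_sum, Finset.sum_mul]
  have hUH : U * (V * H * Vᴴ) = Y := by
    calc U * (V * H * Vᴴ) = U * (V * Vᴴ) * Uᴴ * Y * (V * Vᴴ) := by
          simp only [hH, conjTranspose_mul, mul_assoc]
      _ = Y := by rw [hVV, mul_one, mul_one, hUU, one_mul]
  refine ⟨fun i => V * P i * Vᴴ, fun i => ⟨(hP i).1.mul_mul_conjTranspose_same V, ?_⟩, ?_,
    fun i => ?_, ?_⟩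
  · rw [trace_mul_comm, ← mul_assoc, hVV', one_mul, (hP i).2]
  · rw [hsum, spectralNorm_le_one_iff (h1.mul_mul_conjTranspose_same V)]
    have := h2.mul_mul_conjTranspose_same V
    rwa [mul_sub, sub_mul, mul_one, hVV] at this
  · calc absMatrix A * (V * P i * Vᴴ) = V * singularDiagonal A * (Vᴴ * V) * P i * Vᴴ := by
          rw [habs]; simp only [mul_assoc]
      _ = V * (singularDiagonal A * P i) * Vᴴ := by rw [hVV', mul_one, mul_assoc V]
      _ = _ := by
          rw [singularDiagonal, hPe i, Matrix.mul_smul, Matrix.smul_mul]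
  · rw [hsum, hUH]
    exact hYW

end KyFan

theorem theorem3 {n k : ℕ} (hk : 1 ≤ k) (hkn : k ≤ n)
    (A U : Matrix (Fin n) (Fin n) ℂ) (hU : KyFan.IsPolarDecomposition A U)
    (W : Submodule ℂ (Matrix (Fin n) (Fin n) ℂ)) :
    ((∃ P : Fin k → Matrix (Fin n) (Fin n) ℂ,
        (∀ i, KyFan.IsDensityMatrix (P i)) ∧
        KyFan.spectralNorm (∑ i, P i) ≤ 1 ∧
        (∀ i, KyFan.absMatrix A * P i = ((KyFan.singularValue A i : ℝ) : ℂ) • P i) ∧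
        U * ∑ i, P i ∈ KyFan.traceOrthogonal W) →
      KyFan.IsBirkhoffJamesOrthogonal (KyFan.kyFanNorm k) A W) ∧
    (0 < KyFan.singularValue A (k - 1) →
      KyFan.IsBirkhoffJamesOrthogonal (KyFan.kyFanNorm k) A W →
      ∃ P : Fin k → Matrix (Fin n) (Fin n) ℂ,
        (∀ i, KyFan.IsDensityMatrix (P i)) ∧
        KyFan.spectralNorm (∑ i, P i) ≤ 1 ∧
        (∀ i, KyFan.absMatrix A * P i = ((KyFan.singularValue A i : ℝ) : ℂ) • P i) ∧
        U * ∑ i, P i ∈ KyFan.traceOrthogonal W) :=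
  ⟨fun ⟨_, hP, hsum, heig, horth⟩ =>
      KyFan.isBirkhoffJamesOrthogonal_of_states hkn hU hP hsum heig horth,
    fun hpos h => KyFan.exists_states_of_isBirkhoffJamesOrthogonal hk hkn hU hpos h⟩
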